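/- Let $W=(W,+,0)$ be a commutative monoid, $A$ a set of labels, and $\Sigma$ (process signature) and $\Theta$ (weight signature) algebraic signatures. Write $T^{S}X$ for the set of $S$-terms over variables $X$, $F_WX$ for the set of finitely supported functions $X\to W$, with $F_W(\sigma)(\rho)(y)=\sum_{x\in\sigma^{-1}(y)}\rho(x)$ for $\sigma:X\to Y$, and put $\rho(C)=\sum_{x\in C}\rho(x)$, $|\rho|=\rho(X)$ for $\rho\in F_WX$, $C\subseteq X$. **ULTraS.** A ($W$-weighted, finitely supported) ULTraS on a set $X$ is a relation ${\to}\subseteq X\times A\times F_WX$; it is *image finite* if $\{\rho\mid x\xrightarrow{a}\rho\}$ is finite for all $x,a$. An equivalence relation $R$ on $X$ is a *bisimulation* if $x\mathrel{R}y$ implies, for every $a$: for each $x\xrightarrow{a}\varphi$ there is $y\xrightarrow{a}\psi$ with $\varphi(C)=\psi(C)$ for all $R$-classes $C$, and for each $y\xrightarrow{a}\psi$ there is $x\xrightarrow{a}\varphi$ with $\psi(C)=\varphi(C)$ for all $R$-classes $C$. Two states are *bisimilar* if some bisimulation relates them. A *coalgebra morphism* from an ULTraS on $X$ to one on $Y$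 is a map $f:X\to Y$ with $\{\rho'\mid f(x)\xrightarrow{a}\rho'\}=\{F_W(f)(\rho)\mid x\xrightarrow{a}\rho\}$ for all $x,a$. Two states of $X$ are *behaviourally equivalent* if some coalgebra morphism from $X$ identifies them. **Rules.** A WFSOS rule with source $\mathtt f(x_1,\dots,x_n)$, $\mathtt f\in\Sigma$ of arity $n$, has premises $x_i\xrightarrow{a}\varphi^a_{ij}$ ($1\le i\le n$, $a\in A_i$, $1\le j\le m_i^a$); $x_i\not\xrightarrow{b}$ ($1\le i\le n$, $b\in B_i$); $|\varphi^{a_k}_{i_kj_k}|=w_k$ ($1\le k\le p$); $\varphi^{a_k}_{i_kj_k}(y_k)\neq0$ ($1\le k\le q$); and conclusion $\mathtt f(x_1,\dots,x_n)\xrightarrow{c}\psi$. Here $A_i,B_i\subseteq A$ are disjoint, $q\le p$, all variables are pairwise distinct, $w_k\in W$ with $w_k\ne0$ for $k\le q$, $\psi$ is a $\Theta$-term over the variables $x_i,y_k,\varphi^a_{ij}$, and if $q>0$ then $W$ is zerosumfree ($w+w'=0\Rightarrow w=w'=0$). Rules are identified up to renaming of variables. **Specifications.** An *interpretation* is a family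 of maps $(\!|-|\!)_X:T^\Theta(X+F_WX)\to F_WT^\Sigma X$, indexed by all sets $X$ and natural in $X$ with respect to all maps $\sigma:X\to Y$. An *image-finite WFSOS specification* is a set of rules together with an interpretation, such that only finitely many rules share the same operator $\mathtt f$, conclusion label $c$ and trigger $\langle A_1,\dots,A_n,w_1,\dots,w_p\rangle$. It induces an ULTraS on the set $T^\Sigma\emptyset$ of ground process terms by structural recursion: $\mathtt f(p_1,\dots,p_n)\xrightarrow{c}\rho$ iff there are a rule as above with operator $\mathtt f$ and conclusion label $c$ such that $A_i=\{a\mid \exists\rho'.\ p_i\xrightarrow{a}\rho'\}$ for all $i$, and assignments $\sigma$ of ground terms to the process variables and $\theta$ of elements of $F_WT^\Sigma\emptyset$ to the weight function variables, such that $\sigma(x_i)=p_i$, $p_i\xrightarrow{a}\theta(\varphi^a_{ij})$, $|\theta(\varphi^{a_k}_{i_kj_k})|=w_k$ for $k\le p$, $\theta(\varphi^{a_k}_{i_kj_k})(\sigma(y_k))\neq0$ for $k\le q$, and $$\rho=F_W(\mu)\bigl((\!|\psi[\sigma,\theta]|\!)_{T^\Sigma\emptyset}\bigr),$$ where $\mu:T^\Sigma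 T^\Sigma\emptyset\to T^\Sigma\emptyset$ evaluates terms over ground terms. **Theorem (Congruence).** For every image-finite WFSOS specification, bisimilarity and behavioural equivalence on the induced ULTraS over $T^\Sigma\emptyset$ are both congruences for the operators of $\Sigma$: they are equivalence relations, and if $s_i$ and $t_i$ are related for $1\le i\le n$ then so are $\mathtt f(s_1,\dots,s_n)$ and $\mathtt f(t_1,\dots,t_n)$, for every $n$-ary $\mathtt f\in\Sigma$. If moreover the induced ULTraS is image finite, i.e. a coalgebra for $(\mathcal P_fF_W-)^A$, then behavioural equivalence of $(\mathcal P_fF_W-)^A$-coalgebras (some coalgebra morphism to an image-finite ULTraS identifies the two states) is likewise a congruence on it. -/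

import Mathlib

namespace WFSOS

universe u v

/-! ## Weight functions

For a commutative monoid `W`, the set of finitely supported weight functions on `X` is `X →₀ W`,
and its functorial action on a map `σ : X → Y` is `Finsupp.mapDomain σ`
(sum of the weights over the fibres of `σ`). -/

/-- The weight `ρ(C)` of a set of states `C`, that is, the sum of `ρ x` over `x ∈ C`. -/
noncomputable def weightOn {W X : Type*} [AddCommMonoid W] (ρ : X →₀ W) (C : Set X) : W := by
  classical exact ∑ x ∈ ρ.support with x ∈ C, ρ x

/-- The total weight of a weight function. -/
noncomputable def totalWeight {W X : Type*} [AddCommMonoid W] (ρ : X →₀ W) : W :=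
  weightOn ρ Set.univ

/-- `w + w' = 0` only if `w = w' = 0`. -/
def Zerosumfree (W : Type*) [AddCommMonoid W] : Prop :=
  ∀ w w' : W, w + w' = 0 → w = 0 ∧ w' = 0

/-! ## Uniform labelled transition systems -/

/-- A `W`-weighted uniform labelled transition system with states `X`, labels `A` and finitely
supported weight functions: `ρ ∈ T.trans x a` is the transition from `x` to `ρ` labelled `a`. -/
structure ULTraS (W A X : Type*) [AddCommMonoid W] where
  trans : X → A → Set (X →₀ W)

namespace ULTraS

variable {W A : Type*} [AddCommMonoid W]

/-- Every state has, for each label, only finitely many transitions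
(the weight functions are finitely supported by definition). -/
def ImageFinite {X : Type*} (T : ULTraS W A X) : Prop :=
  ∀ x a, (T.trans x a).Finite

/-- An equivalence relation is a bisimulation if related states match each other's transitions by
weight functions that agree on all equivalence classes. -/
structure IsBisimulation {X : Type*} (T : ULTraS W A X) (R : Setoid X) : Prop where
  forth : ∀ x y, R x y → ∀ a, ∀ φ ∈ T.trans x a, ∃ ψ ∈ T.trans y a,
    ∀ C ∈ R.classes, weightOn φ C = weightOn ψ C
  back : ∀ x y, R x y → ∀ a, ∀ ψ ∈ T.trans y a, ∃ φ ∈ T.trans x a,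
    ∀ C ∈ R.classes, weightOn ψ C = weightOn φ C

/-- Two states are bisimilar if some bisimulation relates them. -/
def Bisimilar {X : Type*} (T : ULTraS W A X) (x y : X) : Prop :=
  ∃ R : Setoid X, T.IsBisimulation R ∧ R x y

/-- `f` is a morphism of the coalgebras `x ↦ (a ↦ {ρ | x goes to ρ by a})`: the transitions of
`f x` are exactly the images under `f` of those of `x`. -/
def IsMorphism {X Y : Type*} (T : ULTraS W A X) (T' : ULTraS W A Y) (f : X → Y) : Prop :=
  ∀ x a, T'.trans (f x) a = Finsupp.mapDomain f '' T.trans x a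

/-- Coalgebraic behavioural equivalence: some coalgebra morphism out of `T` identifies the two
states. -/
def BehaviouralEquiv {X : Type u} (T : ULTraS W A X) (x y : X) : Prop :=
  ∃ (Y : Type u) (T' : ULTraS W A Y) (f : X → Y), T.IsMorphism T' f ∧ f x = f y

/-- Behavioural equivalence of coalgebras whose successor sets are finite: the codomain of the
morphism is required to be image finite too. Meant for an image-finite `T`, which is a coalgebra
for the composite of the finite powerset and the finitely supported weight functions, to the
power `A`. -/
def FinBehaviouralEquiv {X : Type u} (T : ULTraS W A X) (x y : X) : Prop :=
  ∃ (Y : Type u) (T' : ULTraS W A Y) (f : X → Y),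
    T'.ImageFinite ∧ T.IsMorphism T' f ∧ f x = f y

end ULTraS

/-! ## Terms

An algebraic signature is given by the function symbols of a first-order language `L` (its relation
symbols play no role), and `L.Term X` is the set of terms over the variables `X`.
`FirstOrder.Language.Term.relabel` is the action on maps between variable sets. -/

/-- Ground terms of a signature. -/
abbrev Ground (L : FirstOrder.Language.{u, v}) : Type u := L.Term Empty

/-- The inductive extension of the term algebra: evaluate a term over ground terms
to a ground term. -/
def flatten {L : FirstOrder.Language.{u, v}} (t : L.Term (Ground L)) : Ground L := t.subst id

/-- A relation on ground terms is a congruence: an equivalence relation that is preserved by every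
operator of the signature. -/
def IsCongruence {L : FirstOrder.Language.{u, v}} (r : Ground L → Ground L → Prop) : Prop :=
  Equivalence r ∧
    ∀ (n : ℕ) (f : L.Functions n) (s t : Fin n → Ground L),
      (∀ i, r (s i) (t i)) →
        r (FirstOrder.Language.Term.func f s) (FirstOrder.Language.Term.func f t)

/-! ## Rules and specifications -/

/-- Premises, conclusion label and target of a rule whose source is `f(x₁, …, xₙ)` for some `n`-ary
operator `f`. Variables are named canonically: the process variables are `x i` for `i : Fin n` and
`y k` for `k : Fin q`; the weight function variables `φ i a j` are the triples of an argument
position `i`, a label `a ∈ pos i` and an index `j : Fin (mult i a)`. The premises are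
* `x i` goes to `φ i a j` by `a`, for all such triples;
* `x i` has no transition labelled `b`, for `b ∈ neg i`;
* the total weight of `weightVar k` is `weight k`, for `k : Fin p`;
* `y k` is in the support of `weightVar k`, for `k < q`, where `q ≤ p`. -/
structure Rule (W A : Type*) [AddCommMonoid W] (Th : FirstOrder.Language) (n : ℕ) where
  label : A
  pos : Fin n → Set A
  neg : Fin n → Set A
  disjoint : ∀ i, Disjoint (pos i) (neg i)
  mult : ∀ i, pos i → ℕ
  p : ℕ
  q : ℕ
  q_le_p : q ≤ p
  weightVar : Fin p → (Σ i : Fin n, Σ a : pos i, Fin (mult i a))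
  weight : Fin p → W
  weight_ne_zero : ∀ k : Fin p, k.val < q → weight k ≠ 0
  target : Th.Term ((Fin n ⊕ Fin q) ⊕ (Σ i : Fin n, Σ a : pos i, Fin (mult i a)))
  zerosumfree : 0 < q → Zerosumfree W

/-- The weight function variables of a rule. -/
abbrev Rule.WeightVar {W A : Type*} [AddCommMonoid W] {Th : FirstOrder.Language} {n : ℕ}
    (R : Rule W A Th n) : Type _ :=
  Σ i : Fin n, Σ a : R.pos i, Fin (R.mult i a)

/-- A weight term interpretation: a family of maps, one for each set of variables, that respects
all substitutions of variables for variables. -/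
structure Interpretation (W : Type*) [AddCommMonoid W] (Sg : FirstOrder.Language.{u, v})
    (Th : FirstOrder.Language) where
  interp : ∀ X : Type u, Th.Term (X ⊕ (X →₀ W)) → (Sg.Term X →₀ W)
  natural : ∀ {X Y : Type u} (σ : X → Y) (ψ : Th.Term (X ⊕ (X →₀ W))),
    Finsupp.mapDomain (FirstOrder.Language.Term.relabel σ) (interp X ψ) =
      interp Y (ψ.relabel (Sum.map σ (Finsupp.mapDomain σ)))

/-- An image-finite specification with process signature `Sg` and weight signature `Th`: a set of
rules (`rules f` are those with source operator `f`) and an interpretation, such that only finitely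
many rules share source operator, conclusion label and trigger. The trigger of a rule consists of
the sets `pos i` of enabled labels and of the tuple of weight constants. -/
structure Specification (W A : Type*) [AddCommMonoid W] (Sg : FirstOrder.Language.{u, v})
    (Th : FirstOrder.Language) extends Interpretation W Sg Th where
  rules : ∀ {n : ℕ}, Sg.Functions n → Set (Rule W A Th n)
  finite_rules : ∀ {n : ℕ} (f : Sg.Functions n) (c : A) (C : Fin n → Set A) (w : List W),
    {R | R ∈ rules f ∧ R.label = c ∧ R.pos = C ∧ List.ofFn R.weight = w}.Finite

namespace Specification

variable {W A : Type*} [AddCommMonoid W] {Sg : FirstOrder.Language.{u, v}}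
  {Th : FirstOrder.Language}

/-- Given the subterms `t i` of a source term and their transitions `step i`, the weight functions
`ρ` derived by the rule `R`. The rule is triggered when `R.pos i` is exactly the set of enabled
labels of the `i`-th subterm (so the negative premises hold by disjointness). Then `σ` and `θ`
instantiate the process and the weight function variables so that all premises hold, and the
instantiated target is interpreted over the variable set of ground terms and evaluated. -/
def Derives (S : Specification W A Sg Th) {n : ℕ} (t : Fin n → Ground Sg)
    (step : Fin n → A → Set (Ground Sg →₀ W)) (R : Rule W A Th n) (ρ : Ground Sg →₀ W) : Prop :=
  (∀ i, R.pos i = {a | (step i a).Nonempty}) ∧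
  ∃ (σ : Fin n ⊕ Fin R.q → Ground Sg) (θ : R.WeightVar → (Ground Sg →₀ W)),
    (∀ i, σ (Sum.inl i) = t i) ∧
    (∀ (i : Fin n) (a : R.pos i) (j : Fin (R.mult i a)), θ ⟨i, a, j⟩ ∈ step i a) ∧
    (∀ k, totalWeight (θ (R.weightVar k)) = R.weight k) ∧
    (∀ k : Fin R.q, θ (R.weightVar (Fin.castLE R.q_le_p k)) (σ (Sum.inr k)) ≠ 0) ∧
    ρ = Finsupp.mapDomain flatten
      (S.interp (Ground Sg) (R.target.relabel (Sum.map σ θ)))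

/-- The transitions of ground terms, by structural recursion. -/
def inducedTrans (S : Specification W A Sg Th) : Ground Sg → A → Set (Ground Sg →₀ W)
  | .var x => x.elim
  | .func f t => fun c =>
      {ρ | ∃ R ∈ S.rules f, R.label = c ∧ S.Derives t (fun i => S.inducedTrans (t i)) R ρ}

/-- The ULTraS over ground process terms induced by a specification. -/
def induced (S : Specification W A Sg Th) : ULTraS W A (Ground Sg) where
  trans := S.inducedTrans

end Specification

end WFSOS

namespace WFSOS

universe u v

/-! ### Weight functions and their images on quotients -/

section Weights

variable {W X Y : Type*} [AddCommMonoid W]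

/-! Agreement on all `R`-classes means equality after pushing forward to the quotient by `R`
(`forall_classes_weightOn_eq_iff`), so bisimulations become a statement about `mapDomain`. It is
then enough that the congruence generated by bisimilarity is itself a bisimulation, since
bisimilarity contains every bisimulation. This goes by induction on the generation; the only real
case is an operator applied to related arguments (`simulates_func`).

There, a rule that fires on one side fires on the other with matching weight functions, and the two
targets agree modulo the congruence because the interpretation is natural along the quotient map and
the quotient is an algebra (`mapDomain_mk_interp_eq`).

Behavioural equivalence reduces to bisimilarity: kernels of morphisms are bisimulations, and
quotients by bisimulations are morphisms. -/

theorem mapDomain_apply_eq_weightOn (f : X → Y) (ρ : X →₀ W) (y : Y) :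
    Finsupp.mapDomain f ρ y = weightOn ρ (f ⁻¹' {y}) := by
  classical
  rw [Finsupp.mapDomain, Finsupp.sum_apply, Finsupp.sum, weightOn, Finset.sum_filter]
  refine Finset.sum_congr (by congr) fun x _ => ?_
  simp [Finsupp.single_apply]

theorem totalWeight_eq_mapDomain_unit (ρ : X →₀ W) :
    totalWeight ρ = Finsupp.mapDomain (fun _ => ()) ρ () := by
  rw [mapDomain_apply_eq_weightOn, totalWeight]
  refine congrArg (weightOn ρ) ?_
  ext
  simp

theorem totalWeight_mapDomain (f : X → Y) (ρ : X →₀ W) :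
    totalWeight (Finsupp.mapDomain f ρ) = totalWeight ρ := by
  rw [totalWeight_eq_mapDomain_unit, totalWeight_eq_mapDomain_unit, ← Finsupp.mapDomain_comp]

theorem Zerosumfree.eq_zero_of_sum_eq_zero (hW : Zerosumfree W) {s : Finset X} {g : X → W}
    (h : ∑ x ∈ s, g x = 0) : ∀ x ∈ s, g x = 0 := by
  classical
  intro x hx
  rw [← Finset.add_sum_erase s g hx] at h
  exact (hW _ _ h).1

/-- Nonzero weights cannot cancel inside a fibre. This carries premises `φ(y) ≠ 0` to the quotient.
-/
theorem Zerosumfree.mapDomain_apply_ne_zero (hW : Zerosumfree W) (f : X → Y) {ρ : X →₀ W} {x : X}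
    (hx : ρ x ≠ 0) : Finsupp.mapDomain f ρ (f x) ≠ 0 := by
  classical
  intro h
  rw [mapDomain_apply_eq_weightOn, weightOn] at h
  exact hx (hW.eq_zero_of_sum_eq_zero h x (by simp [hx]))

theorem exists_ne_zero_of_mapDomain_apply_ne_zero (f : X → Y) {ρ : X →₀ W} {y : Y}
    (h : Finsupp.mapDomain f ρ y ≠ 0) : ∃ x, f x = y ∧ ρ x ≠ 0 := by
  classical
  rw [mapDomain_apply_eq_weightOn, weightOn] at h
  obtain ⟨x, hx, hne⟩ := Finset.exists_ne_zero_of_sum_ne_zero h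
  exact ⟨x, (Finset.mem_filter.1 hx).2, hne⟩

/-- Weight functions that agree on all equivalence classes are those with the same image on the
quotient. -/
theorem forall_classes_weightOn_eq_iff (R : Setoid X) (φ ψ : X →₀ W) :
    (∀ C ∈ R.classes, weightOn φ C = weightOn ψ C) ↔
      Finsupp.mapDomain (Quotient.mk R) φ = Finsupp.mapDomain (Quotient.mk R) ψ := by
  have key : ∀ x, (Quotient.mk R) ⁻¹' {Quotient.mk R x} = {y | R y x} := by
    intro x
    ext y
    simpa using Quotient.eq (r := R)
  constructor
  · intro h
    ext z
    induction z using Quotient.inductionOn with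
    | h x =>
      rw [mapDomain_apply_eq_weightOn, mapDomain_apply_eq_weightOn, key]
      exact h _ (R.mem_classes x)
  · rintro h C ⟨x, rfl⟩
    rw [← key, ← mapDomain_apply_eq_weightOn, ← mapDomain_apply_eq_weightOn, h]

theorem mapDomain_mk_eq_of_le {R R' : Setoid X} (hle : R ≤ R') {φ ψ : X →₀ W}
    (h : Finsupp.mapDomain (Quotient.mk R) φ = Finsupp.mapDomain (Quotient.mk R) ψ) :
    Finsupp.mapDomain (Quotient.mk R') φ = Finsupp.mapDomain (Quotient.mk R') ψ := by
  have hc : Quotient.mk R' = Quotient.map' (s₁ := R) (s₂ := R') id hle ∘ Quotient.mk R := rfl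
  rw [hc, Finsupp.mapDomain_comp, Finsupp.mapDomain_comp, h]

end Weights

/-! ### Bisimulation and behavioural equivalence -/

namespace ULTraS

section Simulates

variable {W A : Type*} [AddCommMonoid W] {X : Type*}

/-- Every transition of `x` is matched by one of `y`, up to the quotient by `R`. -/
def Simulates (T : ULTraS W A X) (R : Setoid X) (x y : X) : Prop :=
  ∀ a, ∀ φ ∈ T.trans x a, ∃ ψ ∈ T.trans y a,
    Finsupp.mapDomain (Quotient.mk R) φ = Finsupp.mapDomain (Quotient.mk R) ψ

variable {T : ULTraS W A X} {R R' : Setoid X}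

theorem Simulates.refl (x : X) : T.Simulates R x x := fun _ φ hφ => ⟨φ, hφ, rfl⟩

theorem Simulates.trans {x y z : X} (h : T.Simulates R x y) (h' : T.Simulates R y z) :
    T.Simulates R x z := by
  intro a φ hφ
  obtain ⟨ψ, hψ, e⟩ := h a φ hφ
  obtain ⟨χ, hχ, e'⟩ := h' a ψ hψ
  exact ⟨χ, hχ, e.trans e'⟩

theorem Simulates.mono (hle : R ≤ R') {x y : X} (h : T.Simulates R x y) : T.Simulates R' x y := by
  intro a φ hφ
  obtain ⟨ψ, hψ, e⟩ := h a φ hφ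
  exact ⟨ψ, hψ, mapDomain_mk_eq_of_le hle e⟩

theorem isBisimulation_iff : T.IsBisimulation R ↔ ∀ x y, R x y → T.Simulates R x y := by
  constructor
  · intro h x y hxy a φ hφ
    obtain ⟨ψ, hψ, e⟩ := h.forth x y hxy a φ hφ
    exact ⟨ψ, hψ, (forall_classes_weightOn_eq_iff R φ ψ).1 e⟩
  · intro h
    have forth : ∀ x y, R x y → ∀ a, ∀ φ ∈ T.trans x a, ∃ ψ ∈ T.trans y a,
        ∀ C ∈ R.classes, weightOn φ C = weightOn ψ C := by
      intro x y hxy a φ hφ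
      obtain ⟨ψ, hψ, e⟩ := h x y hxy a φ hφ
      exact ⟨ψ, hψ, (forall_classes_weightOn_eq_iff R φ ψ).2 e⟩
    exact ⟨forth, fun x y hxy => forth y x (R.symm hxy)⟩

variable (T) in
-- Composing two bisimulations need not give an equivalence relation, so transitivity of
-- bisimilarity is obtained by closing the union of all bisimulations at once.
theorem isBisimulation_eqvGen_bisimilar :
    T.IsBisimulation (Relation.EqvGen.setoid T.Bisimilar) := by
  have symm : ∀ x y, T.Bisimilar x y → T.Bisimilar y x :=
    fun x y ⟨R, hR, h⟩ => ⟨R, hR, R.symm h⟩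
  have sim : ∀ x y, T.Bisimilar x y →
      T.Simulates (Relation.EqvGen.setoid T.Bisimilar) x y := by
    rintro x y ⟨R, hR, h⟩
    exact (isBisimulation_iff.1 hR x y h).mono
      fun a b hab => Relation.EqvGen.rel a b ⟨R, hR, hab⟩
  rw [isBisimulation_iff]
  intro x y hxy
  suffices h : T.Simulates (Relation.EqvGen.setoid T.Bisimilar) x y ∧
      T.Simulates (Relation.EqvGen.setoid T.Bisimilar) y x from h.1
  induction hxy with
  | rel x y h => exact ⟨sim x y h, sim y x (symm x y h)⟩
  | refl x => exact ⟨.refl x, .refl x⟩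
  | symm x y _ ih => exact ih.symm
  | trans x y z _ _ ih ih' => exact ⟨ih.1.trans ih'.1, ih'.2.trans ih.2⟩

variable (T) in
theorem equivalence_bisimilar : Equivalence T.Bisimilar where
  refl x := ⟨_, isBisimulation_eqvGen_bisimilar T, .refl x⟩
  symm := fun ⟨R, hR, h⟩ => ⟨R, hR, R.symm h⟩
  trans h h' := ⟨_, isBisimulation_eqvGen_bisimilar T,
    .trans _ _ _ (.rel _ _ h) (.rel _ _ h')⟩

end Simulates

section BehaviouralEquiv

variable {W A : Type*} [AddCommMonoid W] {X : Type u} {T : ULTraS W A X}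

theorem IsMorphism.isBisimulation_ker {Y : Type*} {T' : ULTraS W A Y} {f : X → Y}
    (hf : T.IsMorphism T' f) : T.IsBisimulation (Setoid.ker f) := by
  rw [isBisimulation_iff]
  intro x y hxy a φ hφ
  have hxy : f x = f y := hxy
  have hmem : Finsupp.mapDomain f φ ∈ T'.trans (f y) a := by
    rw [← hxy, hf x a]
    exact ⟨φ, hφ, rfl⟩
  rw [hf y a] at hmem
  obtain ⟨ψ, hψ, e⟩ := hmem
  -- The quotient by the kernel embeds in `Y`, so equality of the images on `Y` reflects to the
  -- quotient.
  refine ⟨ψ, hψ, Finsupp.mapDomain_injective (Setoid.kerLift_injective f) ?_⟩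
  rw [← Finsupp.mapDomain_comp, ← Finsupp.mapDomain_comp]
  exact e.symm

/-- The quotient of a system by an equivalence relation. -/
noncomputable def quotient (T : ULTraS W A X) (R : Setoid X) : ULTraS W A (Quotient R) where
  trans z a := Finsupp.mapDomain (Quotient.mk R) '' T.trans z.out a

theorem IsBisimulation.isMorphism_mk {R : Setoid X} (hR : T.IsBisimulation R) :
    T.IsMorphism (T.quotient R) (Quotient.mk R) := by
  rw [isBisimulation_iff] at hR
  have hsub : ∀ x y, R x y → ∀ a, Finsupp.mapDomain (Quotient.mk R) '' T.trans x a ⊆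
      Finsupp.mapDomain (Quotient.mk R) '' T.trans y a := by
    rintro x y hxy a _ ⟨φ, hφ, rfl⟩
    obtain ⟨ψ, hψ, e⟩ := hR x y hxy a φ hφ
    exact ⟨ψ, hψ, e.symm⟩
  intro x a
  exact (hsub _ _ (Quotient.mk_out x) a).antisymm (hsub _ _ (R.symm (Quotient.mk_out x)) a)

theorem ImageFinite.quotient (hT : T.ImageFinite) (R : Setoid X) : (T.quotient R).ImageFinite :=
  fun _ a => (hT _ a).image _

variable (T) in
theorem behaviouralEquiv_eq_bisimilar : T.BehaviouralEquiv = T.Bisimilar := by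
  ext x y
  constructor
  · rintro ⟨Y, T', f, hf, h⟩
    exact ⟨Setoid.ker f, hf.isBisimulation_ker, h⟩
  · rintro ⟨R, hR, h⟩
    exact ⟨Quotient R, T.quotient R, Quotient.mk R, hR.isMorphism_mk, Quotient.sound h⟩

theorem ImageFinite.finBehaviouralEquiv_eq_bisimilar (hT : T.ImageFinite) :
    T.FinBehaviouralEquiv = T.Bisimilar := by
  ext x y
  constructor
  · rintro ⟨Y, T', f, -, hf, h⟩
    exact ⟨Setoid.ker f, hf.isBisimulation_ker, h⟩
  · rintro ⟨R, hR, h⟩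
    exact ⟨Quotient R, T.quotient R, Quotient.mk R, hT.quotient R, hR.isMorphism_mk,
      Quotient.sound h⟩

end BehaviouralEquiv

end ULTraS

/-! ### Congruences on ground terms -/

section Terms

variable {L : FirstOrder.Language.{u, v}}

/-- The congruence generated by a relation on ground terms. -/
inductive CongrGen (r : Ground L → Ground L → Prop) : Ground L → Ground L → Prop
  | rel {s t} : r s t → CongrGen r s t
  | refl (s) : CongrGen r s s
  | symm {s t} : CongrGen r s t → CongrGen r t s
  | trans {s t u} : CongrGen r s t → CongrGen r t u → CongrGen r s u
  | func {n : ℕ} (f : L.Functions n) (s t : Fin n → Ground L) :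
      (∀ i, CongrGen r (s i) (t i)) → CongrGen r (.func f s) (.func f t)

/-- `CongrGen` as a setoid. -/
def CongrGen.setoid (r : Ground L → Ground L → Prop) : Setoid (Ground L) :=
  ⟨CongrGen r, .refl, .symm, .trans⟩

theorem isCongruence_congrGen (r : Ground L → Ground L → Prop) : IsCongruence (CongrGen r) :=
  ⟨(CongrGen.setoid r).iseqv, fun _ => .func⟩

/-- The algebra structure that the quotient of the ground terms by a congruence inherits. -/
theorem exists_comp_relabel_eq_mk_comp_flatten {R : Setoid (Ground L)}
    (hR : IsCongruence (fun s t => R s t)) :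
    ∃ α : L.Term (Quotient R) → Quotient R,
      α ∘ FirstOrder.Language.Term.relabel (Quotient.mk R) = Quotient.mk R ∘ flatten := by
  -- Evaluate on chosen representatives; as `R` is a congruence, the choice does not affect the
  -- class.
  refine ⟨fun t => Quotient.mk R (flatten (t.relabel Quotient.out)), ?_⟩
  funext t
  refine Quotient.sound ?_
  change R _ _
  induction t with
  | var x => exact Quotient.mk_out x
  | func f ts ih => exact hR.2 _ f _ _ ih

end Terms

/-! ### Rules respect congruences -/

namespace Specification

variable {W A : Type*} [AddCommMonoid W] {Sg : FirstOrder.Language.{u, v}}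
  {Th : FirstOrder.Language} (S : Specification W A Sg Th)

/-- The quotient map passes through `flatten` by the quotient algebra and through `interp` by
naturality; it then acts on the substitutions, where the two sides coincide. -/
theorem mapDomain_mk_interp_eq {R : Setoid (Ground Sg)} (hR : IsCongruence (fun s t => R s t))
    {V V' : Type*} (ψ : Th.Term (V ⊕ V')) {σ σ' : V → Ground Sg} {θ θ' : V' → (Ground Sg →₀ W)}
    (hσ : ∀ v, Quotient.mk R (σ v) = Quotient.mk R (σ' v))
    (hθ : ∀ v, Finsupp.mapDomain (Quotient.mk R) (θ v) = Finsupp.mapDomain (Quotient.mk R) (θ' v)) :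
    Finsupp.mapDomain (Quotient.mk R)
        (Finsupp.mapDomain flatten (S.interp (Ground Sg) (ψ.relabel (Sum.map σ θ)))) =
      Finsupp.mapDomain (Quotient.mk R)
        (Finsupp.mapDomain flatten (S.interp (Ground Sg) (ψ.relabel (Sum.map σ' θ')))) := by
  obtain ⟨α, hα⟩ := exists_comp_relabel_eq_mk_comp_flatten hR
  rw [← Finsupp.mapDomain_comp, ← Finsupp.mapDomain_comp, ← hα, Finsupp.mapDomain_comp,
    Finsupp.mapDomain_comp, S.natural, S.natural, FirstOrder.Language.Term.relabel_relabel,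
    FirstOrder.Language.Term.relabel_relabel, Sum.map_comp_map, Sum.map_comp_map]
  rw [show Quotient.mk R ∘ σ = Quotient.mk R ∘ σ' from funext hσ,
    show Finsupp.mapDomain (Quotient.mk R) ∘ θ = Finsupp.mapDomain (Quotient.mk R) ∘ θ' from
      funext hθ]

theorem simulates_func {R : Setoid (Ground Sg)} (hR : IsCongruence (fun s t => R s t))
    {n : ℕ} (f : Sg.Functions n) (s t : Fin n → Ground Sg) (hst : ∀ i, R (s i) (t i))
    (h : ∀ i, S.induced.Simulates R (s i) (t i)) (h' : ∀ i, S.induced.Simulates R (t i) (s i)) :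
    S.induced.Simulates R (.func f s) (.func f t) := by
  rintro c _ ⟨r, hr, hc, hpos, σ, θ, hσ, hθ, hw, hy, rfl⟩
  choose θ' hθ' e using fun v : r.WeightVar => h v.1 v.2.1 (θ v) (hθ v.1 v.2.1 v.2.2)
  -- The class of `σ (Sum.inr k)` has nonzero weight under `θ`, hence under `θ'`, so some member of
  -- it can serve as the new `y k`.
  have hy' : ∀ k : Fin r.q, ∃ y, Quotient.mk R y = Quotient.mk R (σ (Sum.inr k)) ∧
      θ' (r.weightVar (Fin.castLE r.q_le_p k)) y ≠ 0 := by
    intro k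
    apply exists_ne_zero_of_mapDomain_apply_ne_zero
    rw [← e]
    exact (r.zerosumfree k.pos).mapDomain_apply_ne_zero _ (hy k)
  choose y hyσ hyθ using hy'
  refine ⟨_, ⟨r, hr, hc, fun i => ?_, Sum.elim t y, θ', fun _ => rfl, fun i a j => hθ' ⟨i, a, j⟩,
    fun k => ?_, hyθ, rfl⟩, S.mapDomain_mk_interp_eq hR r.target ?_ e⟩
  -- A trigger fixes the enabled labels exactly, so simulation is needed in both directions.
  · rw [hpos i]
    ext a
    constructor
    · rintro ⟨φ, hφ⟩
      obtain ⟨ψ, hψ, -⟩ := h i a φ hφ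
      exact ⟨ψ, hψ⟩
    · rintro ⟨φ, hφ⟩
      obtain ⟨ψ, hψ, -⟩ := h' i a φ hφ
      exact ⟨ψ, hψ⟩
  · rw [← hw k, ← totalWeight_mapDomain (Quotient.mk R), ← e, totalWeight_mapDomain]
  · rintro (i | k)
    · rw [hσ i]
      exact Quotient.sound (hst i)
    · exact (hyσ k).symm

theorem isBisimulation_congrGen_bisimilar :
    S.induced.IsBisimulation (CongrGen.setoid S.induced.Bisimilar) := by
  have sim : ∀ s t, S.induced.Bisimilar s t →
      S.induced.Simulates (CongrGen.setoid S.induced.Bisimilar) s t := by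
    rintro s t ⟨R, hR, h⟩
    exact (ULTraS.isBisimulation_iff.1 hR s t h).mono fun a b hab => CongrGen.rel ⟨R, hR, hab⟩
  rw [ULTraS.isBisimulation_iff]
  intro s t hst
  -- Both directions together: the symmetry and operator cases need the two-sided hypothesis.
  suffices h : S.induced.Simulates (CongrGen.setoid S.induced.Bisimilar) s t ∧
      S.induced.Simulates (CongrGen.setoid S.induced.Bisimilar) t s from h.1
  induction hst with
  | rel h => exact ⟨sim _ _ h, sim _ _ ((ULTraS.equivalence_bisimilar _).symm h)⟩
  | refl s => exact ⟨.refl s, .refl s⟩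
  | symm _ ih => exact ih.symm
  | trans _ _ ih ih' => exact ⟨ih.1.trans ih'.1, ih'.2.trans ih.2⟩
  | func f s t hst ih =>
    have hR := isCongruence_congrGen S.induced.Bisimilar
    exact ⟨S.simulates_func hR f s t hst (fun i => (ih i).1) fun i => (ih i).2,
      S.simulates_func hR f t s (fun i => (hst i).symm) (fun i => (ih i).2) fun i => (ih i).1⟩

theorem isCongruence_bisimilar : IsCongruence S.induced.Bisimilar :=
  ⟨ULTraS.equivalence_bisimilar _, fun _ f s t h =>
    ⟨_, S.isBisimulation_congrGen_bisimilar, .func f s t fun i => .rel (h i)⟩⟩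

end Specification

end WFSOS

theorem mainTheorem1 {W : Type*} [AddCommMonoid W] {A : Type*}
    {Sg Th : FirstOrder.Language} (S : WFSOS.Specification W A Sg Th) :
    WFSOS.IsCongruence S.induced.Bisimilar ∧
    WFSOS.IsCongruence S.induced.BehaviouralEquiv ∧
    (S.induced.ImageFinite → WFSOS.IsCongruence S.induced.FinBehaviouralEquiv) := by
  refine ⟨S.isCongruence_bisimilar, ?_, fun hfin => ?_⟩
  · rw [WFSOS.ULTraS.behaviouralEquiv_eq_bisimilar]
    exact S.isCongruence_bisimilar
  · rw [hfin.finBehaviouralEquiv_eq_bisimilar]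
    exact S.isCongruence_bisimilar
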